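/- A (continuous-time) finite-dimensional LTI system is given by a real realization $(A,B,C,D)$; its modes are the eigenvalues of $A$, counted with algebraic multiplicity, and a mode $\lambda$ is unstable if $\Re\lambda\ge 0$. A matrix is called stable if all its eigenvalues have negative real part. For a square real matrix $A$ let $\mathrm{eig}^+(A)$ be the set of eigenvalues of $A$ in $\{\Re\lambda\ge0\}$. The feedback interconnection of a plant $P_m=(A_m,B_m,C_m,D_m)$ with a controller $K=(A_K,B_K,C_K,0)$ has dynamics matrix $$A_{\mathrm{CL}}(P_m,K)=\begin{pmatrix}A_m & B_mC_K\\ B_KC_m & A_K+B_KD_mC_K\end{pmatrix}.$$ Let $P_m=(A_m,B_m,C_m,D_m)$ be any single-input single-output plant. Then $P_m$ has a Kalman canonical form, that is, a change of state coordinates in which $$A_m\sim\begin{pmatrix}A_{11}&0&A_{13}&0\\A_{21}&A_{22}&A_{23}&A_{24}\\0&0&A_{33}&0\\0&0&A_{43}&A_{44}\end{pmatrix},\quad B_m\sim\begin{pmatrix}B_1\\B_2\\0\\0\end{pmatrix},\quad C_m\sim\begin{pmatrix}C_1&0&C_3&0\end{pmatrix},$$ where the pair $\left(\begin{pmatrix}A_{11}&0\\A_{21}&A_{22}\end{pmatrix},\begin{pmatrix}B_1\\B_2\end{pmatrix}\right)$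 is controllable and the pair $\left(\begin{pmatrix}C_1&C_3\end{pmatrix},\begin{pmatrix}A_{11}&A_{13}\\0&A_{33}\end{pmatrix}\right)$ is observable; the eigenvalues of $A_{11}$ are the controllable and observable modes of $P_m$, and those of $A_{22},A_{33},A_{44}$ are its uncontrollable or unobservable modes. For every such form, and for a row vector $F$ and a column vector $L$ of the size $n_1$ of $A_{11}$, let $K'(F,L)$ be the observer-based controller with realization $(A_{11}-B_1F-LC_1+LD_mF,\;L,\;-F,\;0)$, call $(F,L)$ stabilizing if $A_{11}-B_1F$ and $A_{11}-LC_1$ are stable, and say that $K'$ stabilizes all controllable and observable unstable modes of $P_m$ if for every $\lambda$ with $\Re\lambda\ge0$ the multiplicity of $\lambda$ as an eigenvalue of $A_{\mathrm{CL}}(P_m,K')$ is the sum of its multiplicities in $A_{22}$, $A_{33}$ and $A_{44}$. Then: 1. There is a stabilizing pair $(F,L)$ such that $K'=K'(F,L)$ stabilizes all controllable and observable unstable modes of $P_m$ and $$\mathrm{eig}^+(A_{K'})\cap \mathrm{eig}^+\big(A_{\mathrm{CL}}(P_m,K')\big)=\varnothing,\qquad(\ast)$$ where $A_{K'}$ is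 the dynamics matrix of $K'$. 2. For every stabilizing pair $(F,L)$, the controller $K'(F,L)$ stabilizes all controllable and observable unstable modes of $P_m$, and there is $\varepsilon>0$ such that for every $L_\epsilon\in\mathbb R^{n_1}$ with $\|L_\epsilon\|_\infty<\varepsilon$ the pair $(F,L+L_\epsilon)$ is still stabilizing and $K'(F,L+L_\epsilon)$ still stabilizes all controllable and observable unstable modes of $P_m$, and for Lebesgue-almost every such $L_\epsilon$ the controller $K'(F,L+L_\epsilon)$ also satisfies $(\ast)$. -/

import Mathlib

/-- A state-space realization `(A, B, C, D)` of a finite-dimensional linear time-invariant system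
with real matrices: states indexed by `n`, inputs by `u`, outputs by `y`. -/
structure StateSpace (n u y : Type) where
  A : Matrix n n ℝ
  B : Matrix n u ℝ
  C : Matrix y n ℝ
  D : Matrix y u ℝ

/-- The set of complex eigenvalues of a real square matrix. -/
def eig {n : Type} [Fintype n] [DecidableEq n] (A : Matrix n n ℝ) : Set ℂ :=
  spectrum ℂ (A.map (algebraMap ℝ ℂ))

/-- The unstable eigenvalues: those in the closed right half-plane. -/
def unstableEig {n : Type} [Fintype n] [DecidableEq n] (A : Matrix n n ℝ) : Set ℂ :=
  {z | z ∈ eig A ∧ 0 ≤ z.re}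

/-- All eigenvalues lie in the open left half-plane. -/
def IsStable {n : Type} [Fintype n] [DecidableEq n] (A : Matrix n n ℝ) : Prop :=
  ∀ z ∈ eig A, z.re < 0

/-- The algebraic multiplicity of `z` as an eigenvalue of `A` (zero if it is not one). -/
noncomputable def eigMult {n : Type} [Fintype n] [DecidableEq n] (z : ℂ) (A : Matrix n n ℝ) : ℕ :=
  (A.map (algebraMap ℝ ℂ)).charpoly.rootMultiplicity z

/-- `(A, B)` is controllable: the columns of `B, AB, A²B, …` span the state space. -/
def IsControllable {n u : Type} [Fintype n] [DecidableEq n]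
    (A : Matrix n n ℝ) (B : Matrix n u ℝ) : Prop :=
  Submodule.span ℝ (Set.range fun q : ℕ × u => (A ^ q.1 * B).col q.2) = ⊤

/-- `(C, A)` is observable: the only state with `C x = C A x = C A² x = … = 0` is `x = 0`. -/
def IsObservable {n y : Type} [Fintype n] [DecidableEq n]
    (C : Matrix y n ℝ) (A : Matrix n n ℝ) : Prop :=
  ∀ x : n → ℝ, (∀ k : ℕ, (C * A ^ k).mulVec x = 0) → x = 0

/-- The feedback interconnection of the plant `P` (from `u` to `y`) and the controller `K`
(from `y` to `u`), as a map from the reference input (added to the output of `K` at the input of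
`P`) to the output of `P`. It is meaningful when `1 - D_K D_P` is invertible. -/
noncomputable def StateSpace.lft {n k u y : Type} [Fintype n] [Fintype k]
    [Fintype u] [DecidableEq u] [Fintype y] [DecidableEq y]
    (P : StateSpace n u y) (K : StateSpace k y u) : StateSpace (n ⊕ k) u y :=
  let M : Matrix u u ℝ := (1 - K.D * P.D)⁻¹
  let N : Matrix y y ℝ := (1 - P.D * K.D)⁻¹
  { A := Matrix.fromBlocks
      (P.A + P.B * M * K.D * P.C) (P.B * M * K.C)
      (K.B * N * P.C) (K.A + K.B * P.D * M * K.C)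
    B := Matrix.fromRows (P.B * M) (K.B * P.D * M)
    C := Matrix.fromCols (N * P.C) (P.D * M * K.C)
    D := P.D * M }

/-- A Kalman canonical form of `P`: a change of state coordinates `T` that splits the state into
a controllable and observable part (block 1), a controllable and unobservable part (block 2),
an uncontrollable and observable part (block 3), an uncontrollable and unobservable part (block 4).
The last two fields say that blocks 1 and 2 together are controllable, and that blocks 1 and 3
together are observable. -/
structure KalmanForm {n u y : Type} [Fintype n] [DecidableEq n] (P : StateSpace n u y) where
  (n₁ n₂ n₃ n₄ : ℕ)
  T : Matrix ((Fin n₁ ⊕ Fin n₂) ⊕ (Fin n₃ ⊕ Fin n₄)) n ℝ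
  Tinv : Matrix n ((Fin n₁ ⊕ Fin n₂) ⊕ (Fin n₃ ⊕ Fin n₄)) ℝ
  T_mul_Tinv : T * Tinv = 1
  Tinv_mul_T : Tinv * T = 1
  A₁₁ : Matrix (Fin n₁) (Fin n₁) ℝ
  A₁₃ : Matrix (Fin n₁) (Fin n₃) ℝ
  A₂₁ : Matrix (Fin n₂) (Fin n₁) ℝ
  A₂₂ : Matrix (Fin n₂) (Fin n₂) ℝ
  A₂₃ : Matrix (Fin n₂) (Fin n₃) ℝ
  A₂₄ : Matrix (Fin n₂) (Fin n₄) ℝ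
  A₃₃ : Matrix (Fin n₃) (Fin n₃) ℝ
  A₄₃ : Matrix (Fin n₄) (Fin n₃) ℝ
  A₄₄ : Matrix (Fin n₄) (Fin n₄) ℝ
  B₁ : Matrix (Fin n₁) u ℝ
  B₂ : Matrix (Fin n₂) u ℝ
  C₁ : Matrix y (Fin n₁) ℝ
  C₃ : Matrix y (Fin n₃) ℝ
  A_eq : T * P.A * Tinv = Matrix.fromBlocks
    (Matrix.fromBlocks A₁₁ 0 A₂₁ A₂₂) (Matrix.fromBlocks A₁₃ 0 A₂₃ A₂₄)
    0 (Matrix.fromBlocks A₃₃ 0 A₄₃ A₄₄)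
  B_eq : T * P.B = Matrix.fromRows (Matrix.fromRows B₁ B₂) 0
  C_eq : P.C * Tinv = Matrix.fromCols (Matrix.fromCols C₁ 0) (Matrix.fromCols C₃ 0)
  controllable : IsControllable (Matrix.fromBlocks A₁₁ 0 A₂₁ A₂₂) (Matrix.fromRows B₁ B₂)
  observable : IsObservable (Matrix.fromCols C₁ C₃) (Matrix.fromBlocks A₁₁ A₁₃ 0 A₃₃)

namespace KalmanForm

variable {n u y : Type} [Fintype n] [DecidableEq n] {P : StateSpace n u y}

/-- The state feedback gain `F` and the observer gain `L` are stabilizing for the controllable and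
observable part of the plant. -/
def StabilizingGains [Fintype u] [Fintype y] (κ : KalmanForm P)
    (F : Matrix u (Fin κ.n₁) ℝ) (L : Matrix (Fin κ.n₁) y ℝ) : Prop :=
  IsStable (κ.A₁₁ - κ.B₁ * F) ∧ IsStable (κ.A₁₁ - L * κ.C₁)

/-- The observer-based controller with state feedback gain `F` and observer gain `L` for the
controllable and observable part of the plant. -/
def observerController [Fintype u] [Fintype y] (κ : KalmanForm P)
    (F : Matrix u (Fin κ.n₁) ℝ) (L : Matrix (Fin κ.n₁) y ℝ) : StateSpace (Fin κ.n₁) y u where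
  A := κ.A₁₁ - κ.B₁ * F - L * κ.C₁ + L * P.D * F
  B := L
  C := -F
  D := 0

/-- `K` stabilizes all controllable and observable unstable modes of `P`: the unstable closed-loop
eigenvalues, with multiplicities, are exactly the unstable uncontrollable or unobservable modes of
`P`. Multiplicities matter, since a controllable and observable mode may have the same value as an
uncontrollable or unobservable one. -/
def StabilizesControllableObservable [Fintype u] [DecidableEq u] [Fintype y] [DecidableEq y]
    (κ : KalmanForm P) {k : Type} [Fintype k] [DecidableEq k] (K : StateSpace k y u) : Prop :=
  ∀ z : ℂ, 0 ≤ z.re →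
    eigMult z (P.lft K).A = eigMult z κ.A₂₂ + eigMult z κ.A₃₃ + eigMult z κ.A₄₄

end KalmanForm

/-!
The Kalman form is obtained from coordinates adapted to the reachable subspace and the unobservable
subspace (`KalmanForm.nonempty`).

In these coordinates the closed loop with an observer-based controller is block triangular. Its
diagonal blocks are `A₂₂`, `A₃₃`, `A₄₄` and the loop formed by block 1 and its observer, whose
characteristic polynomial is that of `A₁₁ - B₁ F` times that of `A₁₁ - L C₁` by the separation
principle (`KalmanForm.charpoly_lft_observerController`). Hence stabilizing gains leave exactly the
unstable modes of `A₂₂`, `A₃₃`, `A₄₄`, whatever `F` and `L` are.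

Stabilizing gains exist because `(A₁₁, B₁)` is controllable and `(C₁, A₁₁)` is observable: pole
placement by Ackermann's formula (`exists_feedback_add_one_pow_eq_zero`) and duality.

Stability is an open condition by the upper hemicontinuity of the spectrum, so a small change `l`
of `L` keeps the gains stabilizing. The controller matrix is
`(A₁₁ - B₁ F) - (L + l) (C₁ - D F)`, a perturbation of rank at most one of the stable matrix
`A₁₁ - B₁ F`. For a fixed `z` in the closed right half-plane, the determinant of `z` minus this
matrix is therefore an affine function of `l` that does not vanish at `l = -L`, and its zero set is
null (`ae_notMem_eig_sub_mul`). The unstable closed-loop modes range over a fixed finite set, so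
almost every `l` separates them from the controller modes; in particular some arbitrarily small
`l` does.
-/

/-! ### Pole placement and duality -/

section

open Polynomial

/-- Pole placement at `-1` by state feedback: if `b` is a cyclic vector of `f`, some feedback `g`
makes `f - b g + 1` nilpotent. With `h = f + 1`, `n` the dimension and `φ` the functional that
vanishes on `b, h b, …, hⁿ⁻² b` and takes the value `1` on `hⁿ⁻¹ b`, the feedback is Ackermann's
`g = φ hⁿ`. -/
theorem exists_feedback_add_one_pow_eq_zero {K V : Type*} [Field K] [AddCommGroup V] [Module K V]
    [FiniteDimensional K V] (f : Module.End K V) (b : V)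
    (hb : Submodule.span K (Set.range fun k : ℕ => (f ^ k) b) = ⊤) :
    ∃ g : V →ₗ[K] K, (f - g.smulRight b + 1) ^ Module.finrank K V = 0 := by
  set n := Module.finrank K V with hn
  set h : Module.End K V := f + 1 with hh
  -- Since `b` is cyclic, `q ↦ q(h) b` identifies the polynomials of degree `< n` with `V`.
  let Ψ : degreeLT K n →ₗ[K] V :=
    (LinearMap.applyₗ b ∘ₗ (aeval h).toLinearMap) ∘ₗ (degreeLT K n).subtype
  have hΨ (q : degreeLT K n) : Ψ q = aeval h q.1 b := rfl
  have hsurj : Function.Surjective Ψ := by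
    rw [← LinearMap.range_eq_top, eq_top_iff, ← hb, Submodule.span_le]
    rintro _ ⟨k, rfl⟩
    refine ⟨⟨(X - 1) ^ k %ₘ h.charpoly, ?_⟩, ?_⟩
    · rw [mem_degreeLT]
      have := degree_modByMonic_lt ((X - 1 : K[X]) ^ k) h.charpoly_monic
      rwa [degree_eq_natDegree h.charpoly_monic.ne_zero, LinearMap.charpoly_natDegree] at this
    · rw [hΨ]
      change aeval h ((X - 1) ^ k %ₘ h.charpoly) b = _
      rw [aeval_modByMonic_eq_self_of_root (LinearMap.aeval_self_charpoly h)]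
      simp [hh]
  have hfin : Module.finrank K (degreeLT K n) = Module.finrank K V := by
    rw [(degreeLTEquiv K n).finrank_eq, Module.finrank_fin_fun]
  let e : degreeLT K n ≃ₗ[K] V := LinearEquiv.ofBijective Ψ
    ⟨(LinearMap.injective_iff_surjective_of_finrank_eq_finrank hfin).2 hsurj, hsurj⟩
  -- `φ (q(h) b)` is the coefficient of `X ^ (n - 1)` in `q`.
  let φ : V →ₗ[K] K := lcoeff K (n - 1) ∘ₗ (degreeLT K n).subtype ∘ₗ e.symm.toLinearMap
  have hφ (q : K[X]) (hq : q.degree < n) : φ (aeval h q b) = q.coeff (n - 1) := by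
    have : e.symm (aeval h q b) = ⟨q, mem_degreeLT.2 hq⟩ := by
      rw [LinearEquiv.symm_apply_eq]; rfl
    simp [φ, this]
  have hφb (i : ℕ) (hi : i + 1 < n) : φ ((h ^ i) b) = 0 := by
    have := hφ (X ^ i) (by rw [degree_X_pow]; exact_mod_cast (by omega))
    rw [map_pow, aeval_X] at this
    rw [this, coeff_X_pow, if_neg (by omega)]
  have hφn (hn0 : 0 < n) : φ ((h ^ (n - 1)) b) = 1 := by
    have := hφ (X ^ (n - 1)) (by rw [degree_X_pow]; exact_mod_cast (by omega))
    rw [map_pow, aeval_X] at this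
    rw [this, coeff_X_pow, if_pos rfl]
  -- The functionals `φ, φ h, …, φ hⁿ⁻¹` separate points: if `y = q(h) b` with `q` of degree `d`,
  -- then `φ (hⁿ⁻¹⁻ᵈ y)` is the leading coefficient of `q`.
  have hsep (y : V) (hy : ∀ i < n, φ ((h ^ i) y) = 0) : y = 0 := by
    obtain ⟨⟨q, hq⟩, rfl⟩ := e.surjective y
    change ∀ i < n, φ ((h ^ i) (aeval h q b)) = 0 at hy
    by_contra hne
    have hq0 : q ≠ 0 := by
      rintro rfl
      exact hne (map_zero e)
    have hd : q.natDegree < n := by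
      rw [mem_degreeLT] at hq
      exact (natDegree_lt_iff_degree_lt hq0).2 hq
    have h1 := hy (n - 1 - q.natDegree) (by omega)
    have h2 := hφ (X ^ (n - 1 - q.natDegree) * q) (by
      rw [degree_mul, degree_X_pow, degree_eq_natDegree hq0]
      exact_mod_cast (by omega))
    rw [map_mul, map_pow, aeval_X, Module.End.mul_apply, h1, coeff_X_pow_mul', if_pos (by omega),
      show n - 1 - (n - 1 - q.natDegree) = q.natDegree by omega] at h2
    exact hq0 (leadingCoeff_eq_zero.1 h2.symm)
  refine ⟨φ ∘ₗ (h ^ n), ?_⟩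
  set c : Module.End K V := f - (φ ∘ₗ (h ^ n)).smulRight b + 1 with hc
  have hcx (x : V) : c x = h x - φ ((h ^ n) x) • b := by
    simp only [hc, hh, LinearMap.add_apply, LinearMap.sub_apply, LinearMap.smulRight_apply,
      LinearMap.comp_apply]
    abel
  -- The feedback does not affect `φ hⁱ` for `i < n`, because `φ (hⁱ b) = 0` for `i + 1 < n`, and
  -- it cancels `φ hⁿ`.
  have hlt (i : ℕ) (hi : i < n) (x : V) : φ ((c ^ i) x) = φ ((h ^ i) x) := by
    induction i generalizing x with
    | zero => rfl
    | succ i ih =>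
      rw [pow_succ, Module.End.mul_apply, ih (by omega), hcx, map_sub, map_sub, map_smul, map_smul,
        hφb i hi, smul_zero, sub_zero, pow_succ, Module.End.mul_apply]
  have htop (x : V) : φ ((c ^ n) x) = 0 := by
    rcases Nat.eq_zero_or_pos n with h0 | h0
    · have : Subsingleton V := Module.finrank_zero_iff.1 (hn ▸ h0)
      rw [Subsingleton.elim ((c ^ n) x) 0, map_zero]
    · obtain ⟨m, hm⟩ : ∃ m, n = m + 1 := ⟨n - 1, by omega⟩
      have h1 := hφn h0
      rw [hm, Nat.add_sub_cancel] at h1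
      rw [hm, pow_succ, Module.End.mul_apply, hlt m (by omega), hcx, map_sub, map_sub, map_smul,
        map_smul, h1, hm, pow_succ, Module.End.mul_apply, smul_eq_mul, mul_one, sub_self]
  ext x
  refine hsep _ fun i hi => ?_
  rw [← hlt i hi, ← Module.End.mul_apply, ← pow_add, add_comm, pow_add, Module.End.mul_apply, htop]

end

theorem IsControllable.exists_isStable {n : ℕ} {A : Matrix (Fin n) (Fin n) ℝ}
    {B : Matrix (Fin n) (Fin 1) ℝ} (h : IsControllable A B) :
    ∃ F : Matrix (Fin 1) (Fin n) ℝ, IsStable (A - B * F) := by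
  obtain ⟨g, hg⟩ := exists_feedback_add_one_pow_eq_zero (Matrix.toLin' A) (B.col 0) (by
    rw [← h]
    congr 1
    ext x
    constructor
    · rintro ⟨k, rfl⟩
      refine ⟨(k, 0), ?_⟩
      simp only
      rw [← Matrix.toLin'_pow, Matrix.toLin'_apply]
      rfl
    · rintro ⟨⟨k, i⟩, rfl⟩
      refine ⟨k, ?_⟩
      obtain rfl := Subsingleton.elim i 0
      simp only
      rw [← Matrix.toLin'_pow, Matrix.toLin'_apply]
      rfl)
  let F : Matrix (Fin 1) (Fin n) ℝ := LinearMap.toMatrix' ((LinearMap.pi fun _ => g))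
  have hF : Matrix.toLin' (A - B * F + 1) = Matrix.toLin' A - g.smulRight (B.col 0) + 1 := by
    refine LinearMap.ext fun x => ?_
    have hFx : F.mulVec x = fun _ => g x := LinearMap.toMatrix'_mulVec _ x
    rw [Matrix.toLin'_apply, Matrix.add_mulVec, Matrix.sub_mulVec, ← Matrix.mulVec_mulVec, hFx]
    ext i
    simp [Matrix.mulVec, dotProduct, mul_comm]
  have hnil : (A - B * F + 1) ^ n = 0 := by
    apply Matrix.toLin'.injective
    rw [Matrix.toLin'_pow, hF, map_zero, ← hg, Module.finrank_fin_fun]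
  refine ⟨F, fun z hz => ?_⟩
  rcases Nat.eq_zero_or_pos n with rfl | hn
  · have : Subsingleton (Matrix (Fin 0) (Fin 0) ℂ) := inferInstance
    exact absurd (isUnit_of_subsingleton _) hz
  have : NeZero n := ⟨hn.ne'⟩
  set N := (A - B * F).map (algebraMap ℝ ℂ) with hN
  have hN1 : (N + 1) ^ n = 0 := by
    have := congrArg ((algebraMap ℝ ℂ).mapMatrix) hnil
    rwa [map_pow, map_add, map_one, map_zero] at this
  have h1 : z + 1 ∈ spectrum ℂ (N + 1) := by
    have := (spectrum.add_mem_add_iff (s := (1 : ℂ)) (a := N) (r := z)).2 hz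
    rwa [map_one, add_comm 1 N] at this
  have h2 := spectrum.pow_mem_pow (N + 1) n h1
  rw [hN1, spectrum.zero_eq, Set.mem_singleton_iff, pow_eq_zero_iff hn.ne'] at h2
  rw [eq_neg_of_add_eq_zero_left h2]
  simp

theorem eig_transpose {n : Type} [Fintype n] [DecidableEq n] (A : Matrix n n ℝ) :
    eig A.transpose = eig A := by
  ext z
  rw [eig, eig, Matrix.transpose_map, Matrix.mem_spectrum_iff_isRoot_charpoly,
    Matrix.mem_spectrum_iff_isRoot_charpoly, Matrix.charpoly_transpose]

/-- Duality of observability and controllability: a functional that vanishes on the reachable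
subspace of `(Aᵀ, Cᵀ)` is the dot product with an unobservable state of `(C, A)`. -/
theorem IsObservable.isControllable_transpose {n y : Type} [Fintype n] [DecidableEq n]
    {C : Matrix y n ℝ} {A : Matrix n n ℝ} (h : IsObservable C A) :
    IsControllable A.transpose C.transpose := by
  rw [IsControllable]
  by_contra hne
  obtain ⟨g, hg, hle⟩ := Submodule.exists_le_ker_of_lt_top _ (lt_top_iff_ne_top.2 hne)
  refine hg ?_
  obtain ⟨x, rfl⟩ := (dotProductEquiv ℝ n).surjective g
  rw [h x fun k => ?_, map_zero]
  ext i
  have := hle (Submodule.subset_span ⟨(k, i), rfl⟩)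
  rw [LinearMap.mem_ker, dotProductEquiv_apply_apply, dotProduct_comm] at this
  simp only at this
  rw [← Matrix.transpose_pow, ← Matrix.transpose_mul] at this
  exact this

theorem IsObservable.exists_isStable {n : ℕ} {A : Matrix (Fin n) (Fin n) ℝ}
    {C : Matrix (Fin 1) (Fin n) ℝ} (h : IsObservable C A) :
    ∃ L : Matrix (Fin n) (Fin 1) ℝ, IsStable (A - L * C) := by
  obtain ⟨F, hF⟩ := h.isControllable_transpose.exists_isStable
  refine ⟨F.transpose, ?_⟩
  rwa [IsStable, ← eig_transpose, Matrix.transpose_sub, Matrix.transpose_mul,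
    Matrix.transpose_transpose]

/-! ### Existence of the Kalman canonical form -/

/-- Coordinates adapted to two subspaces `R` and `N`: `R` consists of the vectors supported on
blocks 1 and 2, `N` of those supported on blocks 2 and 4. -/
theorem exists_equiv_adapted {K E : Type*} [Field K] [AddCommGroup E] [Module K E]
    [FiniteDimensional K E] (R N : Submodule K E) :
    ∃ (n₁ n₂ n₃ n₄ : ℕ) (e : E ≃ₗ[K] ((Fin n₁ ⊕ Fin n₂) ⊕ (Fin n₃ ⊕ Fin n₄) → K)),
      (∀ x, x ∈ R ↔ ∀ i, e x (.inr i) = 0) ∧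
      (∀ x, x ∈ N ↔ (∀ i, e x (.inl (.inl i)) = 0) ∧ ∀ i, e x (.inr (.inl i)) = 0) := by
  -- `R = (R ⊓ N) ⊕ V₁`, `N = (R ⊓ N) ⊕ V₄`, and `V₃` is a complement of `R ⊔ N`.
  obtain ⟨V₁, hd₁, hs₁⟩ :=
    IsModularLattice.exists_disjoint_and_sup_eq (inf_le_left : R ⊓ N ≤ R)
  obtain ⟨V₄, hd₄, hs₄⟩ :=
    IsModularLattice.exists_disjoint_and_sup_eq (inf_le_right : R ⊓ N ≤ N)
  obtain ⟨V₃, hV₃⟩ := exists_isCompl (R ⊔ N)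
  let V₂ : Submodule K E := R ⊓ N
  have h₁R : V₁ ≤ R := hs₁ ▸ le_sup_right
  have h₄N : V₄ ≤ N := hs₄ ▸ le_sup_right
  have z₃ {x : E} (h : x ∈ R ⊔ N) (h' : x ∈ V₃) : x = 0 :=
    Submodule.disjoint_def.1 hV₃.disjoint x h h'
  have z₁ {x : E} (h : x ∈ N) (h' : x ∈ V₁) : x = 0 :=
    Submodule.disjoint_def.1 hd₁ x ⟨h₁R h', h⟩ h'
  have z₄ {x : E} (h : x ∈ R) (h' : x ∈ V₄) : x = 0 :=
    Submodule.disjoint_def.1 hd₄ x ⟨h, h₄N h'⟩ h'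
  let Φ : ((V₁ × V₂) × (V₃ × V₄)) →ₗ[K] E :=
    (V₁.subtype.coprod V₂.subtype).coprod (V₃.subtype.coprod V₄.subtype)
  have hΦ (v) : Φ v = (v.1.1 + v.1.2 : E) + (v.2.1 + v.2.2) := rfl
  have hR (v) : Φ v ∈ R ↔ v.2 = 0 := by
    obtain ⟨⟨⟨v₁, h₁⟩, ⟨v₂, h₂⟩⟩, ⟨⟨v₃, h₃⟩, ⟨v₄, h₄⟩⟩⟩ := v
    simp only [hΦ, Prod.mk_eq_zero, Submodule.mk_eq_zero]
    rw [Submodule.add_mem_iff_right _ (R.add_mem (h₁R h₁) h₂.1)]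
    constructor
    · intro h
      have e₃ : v₃ = 0 := z₃ (by
        rw [← Submodule.add_mem_iff_left _ (Submodule.mem_sup_right (h₄N h₄))]
        exact Submodule.mem_sup_left h) h₃
      subst e₃
      rw [zero_add] at h
      exact ⟨rfl, z₄ h h₄⟩
    · rintro ⟨rfl, rfl⟩
      simp
  have hN (v) : Φ v ∈ N ↔ v.1.1 = 0 ∧ v.2.1 = 0 := by
    obtain ⟨⟨⟨v₁, h₁⟩, ⟨v₂, h₂⟩⟩, ⟨⟨v₃, h₃⟩, ⟨v₄, h₄⟩⟩⟩ := v
    simp only [hΦ, Submodule.mk_eq_zero]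
    rw [show v₁ + v₂ + (v₃ + v₄) = (v₁ + v₃) + (v₂ + v₄) by abel,
      Submodule.add_mem_iff_left _ (N.add_mem h₂.2 (h₄N h₄))]
    constructor
    · intro h
      have e₃ : v₃ = 0 := z₃ (by
        rw [← Submodule.add_mem_iff_right _ (Submodule.mem_sup_left (h₁R h₁))]
        exact Submodule.mem_sup_right h) h₃
      subst e₃
      rw [add_zero] at h
      exact ⟨z₁ h h₁, rfl⟩
    · rintro ⟨rfl, rfl⟩
      simp
  have hinj : Function.Injective Φ := by
    rw [← LinearMap.ker_eq_bot, LinearMap.ker_eq_bot']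
    intro v hv
    have h1 := (hR v).1 (hv ▸ R.zero_mem)
    have h2 := (hN v).1 (hv ▸ N.zero_mem)
    obtain ⟨⟨v₁, v₂⟩, w⟩ := v
    obtain rfl : w = 0 := h1
    obtain rfl : v₁ = 0 := h2.1
    have : (v₂ : E) = 0 := by simpa [hΦ] using hv
    rw [Submodule.coe_eq_zero] at this
    rw [this]
    rfl
  have hsurj : Function.Surjective Φ := by
    rw [← LinearMap.range_eq_top]
    simp only [Φ, LinearMap.range_coprod, Submodule.range_subtype]
    rw [eq_top_iff, ← hV₃.sup_eq_top, sup_le_iff, sup_le_iff]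
    refine ⟨⟨?_, ?_⟩, ?_⟩
    · rw [← hs₁, sup_comm]
      exact le_sup_left
    · rw [← hs₄]
      exact sup_le (le_sup_of_le_left le_sup_right) (le_sup_of_le_right le_sup_right)
    · exact le_sup_of_le_right le_sup_left
  let c (V : Submodule K E) : V ≃ₗ[K] (Fin (Module.finrank K V) → K) :=
    (Module.finBasis K V).equivFun
  let s : ((V₁ × V₂) × (V₃ × V₄)) ≃ₗ[K] _ :=
    ((((c V₁).prodCongr (c V₂)).trans
      (LinearEquiv.sumArrowLequivProdArrow _ _ K K).symm).prodCongr
      (((c V₃).prodCongr (c V₄)).trans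
      (LinearEquiv.sumArrowLequivProdArrow _ _ K K).symm)).trans
      (LinearEquiv.sumArrowLequivProdArrow _ _ K K).symm
  let p : ((V₁ × V₂) × (V₃ × V₄)) ≃ₗ[K] E := LinearEquiv.ofBijective Φ ⟨hinj, hsurj⟩
  have hp (v) : p.symm (Φ v) = v := p.symm_apply_apply v
  have hc (V : Submodule K E) (v : V) : v = 0 ↔ ∀ i, c V v i = 0 := by
    rw [← (c V).map_eq_zero_iff, funext_iff]
    rfl
  refine ⟨_, _, _, _, p.symm.trans s, fun x => ?_, fun x => ?_⟩ <;>
    obtain ⟨v, rfl⟩ := hsurj x <;>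
    rw [LinearEquiv.trans_apply, hp]
  · rw [hR, Prod.ext_iff, Sum.forall]
    exact and_congr (hc _ _) (hc _ _)
  · rw [hN]
    exact and_congr (hc _ _) (hc _ _)

/-- The reachable subspace of `(A, B)`: the span of the columns of `B, AB, A²B, …`. -/
def reachableSubspace {n u : Type} [Fintype n] [DecidableEq n]
    (A : Matrix n n ℝ) (B : Matrix n u ℝ) : Submodule ℝ (n → ℝ) :=
  Submodule.span ℝ (Set.range fun q : ℕ × u => (A ^ q.1 * B).col q.2)

/-- The unobservable subspace of `(C, A)`: the states `x` with `C x = C A x = C A² x = … = 0`. -/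
def unobservableSubspace {n y : Type} [Fintype n] [DecidableEq n]
    (C : Matrix y n ℝ) (A : Matrix n n ℝ) : Submodule ℝ (n → ℝ) :=
  ⨅ k : ℕ, LinearMap.ker (C * A ^ k).mulVecLin

section

variable {n u y : Type} [Fintype n] [DecidableEq n]

theorem mem_unobservableSubspace {C : Matrix y n ℝ} {A : Matrix n n ℝ} {x : n → ℝ} :
    x ∈ unobservableSubspace C A ↔ ∀ k : ℕ, (C * A ^ k).mulVec x = 0 := by
  simp [unobservableSubspace]

theorem mulVec_mem_reachableSubspace {A : Matrix n n ℝ} {B : Matrix n u ℝ} {x : n → ℝ}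
    (hx : x ∈ reachableSubspace A B) : A.mulVec x ∈ reachableSubspace A B := by
  have : reachableSubspace A B ≤ (reachableSubspace A B).comap A.mulVecLin := by
    refine Submodule.span_le.2 ?_
    rintro _ ⟨⟨k, i⟩, rfl⟩
    refine Submodule.subset_span ⟨(k + 1, i), ?_⟩
    simp only [pow_succ', Matrix.mul_assoc]
    rfl
  exact this hx

theorem mulVec_mem_unobservableSubspace {C : Matrix y n ℝ} {A : Matrix n n ℝ} {x : n → ℝ}
    (hx : x ∈ unobservableSubspace C A) : A.mulVec x ∈ unobservableSubspace C A := by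
  rw [mem_unobservableSubspace] at hx ⊢
  intro k
  rw [Matrix.mulVec_mulVec, Matrix.mul_assoc, ← pow_succ]
  exact hx (k + 1)

theorem col_mem_reachableSubspace (A : Matrix n n ℝ) (B : Matrix n u ℝ) (i : u) :
    B.col i ∈ reachableSubspace A B :=
  Submodule.subset_span ⟨(0, i), by simp⟩

theorem mulVec_eq_zero_of_mem_unobservableSubspace {C : Matrix y n ℝ} {A : Matrix n n ℝ}
    {x : n → ℝ} (hx : x ∈ unobservableSubspace C A) : C.mulVec x = 0 := by
  simpa using mem_unobservableSubspace.1 hx 0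

end

theorem pow_mul_eq_mul_pow_of_mul_eq {m n R : Type*} [Fintype m] [DecidableEq m] [Fintype n]
    [DecidableEq n] [CommRing R] {A : Matrix m m R} {A' : Matrix n n R} {T : Matrix m n R}
    (h : A * T = T * A') (k : ℕ) : A ^ k * T = T * A' ^ k := by
  induction k with
  | zero => simp
  | succ k ih => rw [pow_succ, Matrix.mul_assoc, h, ← Matrix.mul_assoc, ih, Matrix.mul_assoc,
      pow_succ]

/-- Every realization has a Kalman canonical form, given by coordinates adapted to its reachable and
unobservable subspaces. The zero blocks express the invariance of these subspaces. -/
theorem KalmanForm.nonempty {n u y : Type} [Fintype n] [DecidableEq n] (P : StateSpace n u y) :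
    Nonempty (KalmanForm P) := by
  obtain ⟨n₁, n₂, n₃, n₄, e, hR, hN⟩ :=
    exists_equiv_adapted (reachableSubspace P.A P.B) (unobservableSubspace P.C P.A)
  let T := LinearMap.toMatrix' e.toLinearMap
  let S := LinearMap.toMatrix' e.symm.toLinearMap
  have hT (x : n → ℝ) : T.mulVec x = e x := LinearMap.toMatrix'_mulVec _ x
  have hS (x) : S.mulVec x = e.symm x := LinearMap.toMatrix'_mulVec _ x
  have hTS : T * S = 1 := by
    rw [← LinearMap.toMatrix'_comp]
    simp
  have hST : S * T = 1 := by
    rw [← LinearMap.toMatrix'_comp]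
    simp
  let A' := T * P.A * S
  let B' := T * P.B
  let C' := P.C * S
  have hcol (j) : S.col j = e.symm (Pi.single j 1) := by
    rw [← hS, Matrix.mulVec_single_one]
  have hA' (i j) : A' i j = e (P.A.mulVec (e.symm (Pi.single j 1))) i := by
    rw [← hT, ← hcol, Matrix.mulVec_mulVec]
    rfl
  have hB' (i j) : B' i j = e (P.B.col j) i := by
    rw [← hT]
    rfl
  have hC' (i j) : C' i j = P.C.mulVec (e.symm (Pi.single j 1)) i := by
    rw [← hcol]
    rfl
  have sR (j) : e.symm (Pi.single (.inl j) 1) ∈ reachableSubspace P.A P.B := by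
    rw [hR]
    intro i
    simp
  have sN₂ (j) : e.symm (Pi.single (.inl (.inr j)) 1) ∈ unobservableSubspace P.C P.A := by
    rw [hN]
    simp
  have sN₄ (j) : e.symm (Pi.single (.inr (.inr j)) 1) ∈ unobservableSubspace P.C P.A := by
    rw [hN]
    simp
  have z₂₁ : A'.toBlocks₂₁ = 0 := by
    ext i j
    exact (hA' _ _).trans ((hR _).1 (mulVec_mem_reachableSubspace (sR j)) i)
  have z12 : A'.toBlocks₁₁.toBlocks₁₂ = 0 := by
    ext i j
    exact (hA' _ _).trans (((hN _).1 (mulVec_mem_unobservableSubspace (sN₂ j))).1 i)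
  have z14 : A'.toBlocks₁₂.toBlocks₁₂ = 0 := by
    ext i j
    exact (hA' _ _).trans (((hN _).1 (mulVec_mem_unobservableSubspace (sN₄ j))).1 i)
  have z34 : A'.toBlocks₂₂.toBlocks₁₂ = 0 := by
    ext i j
    exact (hA' _ _).trans (((hN _).1 (mulVec_mem_unobservableSubspace (sN₄ j))).2 i)
  have A_eq : A' = Matrix.fromBlocks
      (Matrix.fromBlocks A'.toBlocks₁₁.toBlocks₁₁ 0 A'.toBlocks₁₁.toBlocks₂₁
        A'.toBlocks₁₁.toBlocks₂₂)
      (Matrix.fromBlocks A'.toBlocks₁₂.toBlocks₁₁ 0 A'.toBlocks₁₂.toBlocks₂₁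
        A'.toBlocks₁₂.toBlocks₂₂)
      0 (Matrix.fromBlocks A'.toBlocks₂₂.toBlocks₁₁ 0 A'.toBlocks₂₂.toBlocks₂₁
        A'.toBlocks₂₂.toBlocks₂₂) := by
    rw [← z12, ← z14, ← z34, ← z₂₁]
    simp only [Matrix.fromBlocks_toBlocks]
  have B_eq : B' = Matrix.fromRows (Matrix.fromRows B'.toRows₁.toRows₁ B'.toRows₁.toRows₂) 0 := by
    have : B'.toRows₂ = 0 := by
      ext i j
      exact (hB' _ _).trans ((hR _).1 (col_mem_reachableSubspace P.A P.B j) i)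
    rw [← this]
    simp only [Matrix.fromRows_toRows]
  have C_eq : C' = Matrix.fromCols (Matrix.fromCols C'.toCols₁.toCols₁ 0)
      (Matrix.fromCols C'.toCols₂.toCols₁ 0) := by
    have h2 : C'.toCols₁.toCols₂ = 0 := by
      ext i j
      exact (hC' _ _).trans (congrFun (mulVec_eq_zero_of_mem_unobservableSubspace (sN₂ j)) i)
    have h4 : C'.toCols₂.toCols₂ = 0 := by
      ext i j
      exact (hC' _ _).trans (congrFun (mulVec_eq_zero_of_mem_unobservableSubspace (sN₄ j)) i)
    ext i ((j | j) | (j | j))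
    · rfl
    · exact congrFun (congrFun h2 i) j
    · rfl
    · exact congrFun (congrFun h4 i) j
  have hTA : T * P.A = A' * T := by
    rw [Matrix.mul_assoc, hST, Matrix.mul_one]
  have hAS : P.A * S = S * A' := by
    simp only [A', ← Matrix.mul_assoc, hST, Matrix.one_mul]
  refine ⟨⟨n₁, n₂, n₃, n₄, T, S, hTS, hST, _, _, _, _, _, _, _, _, _, _, _, _, _, A_eq, B_eq, C_eq,
    ?_, ?_⟩⟩
  · set Ac := Matrix.fromBlocks A'.toBlocks₁₁.toBlocks₁₁ 0 A'.toBlocks₁₁.toBlocks₂₁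
        A'.toBlocks₁₁.toBlocks₂₂
    set Bc := Matrix.fromRows B'.toRows₁.toRows₁ B'.toRows₁.toRows₂
    -- `ι` includes blocks 1 and 2 in the whole state space, intertwining `Ac` with `A'`.
    let ι : Matrix ((Fin n₁ ⊕ Fin n₂) ⊕ (Fin n₃ ⊕ Fin n₄)) (Fin n₁ ⊕ Fin n₂) ℝ :=
      Matrix.fromRows 1 0
    have hAι : A' * ι = ι * Ac := by
      rw [A_eq]
      simp [ι, Matrix.fromBlocks_mul_fromRows, Matrix.fromRows_mul]
    have hBι : B' = ι * Bc := by
      rw [B_eq]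
      simp [ι, Matrix.fromRows_mul]
    let π : ((Fin n₁ ⊕ Fin n₂) ⊕ (Fin n₃ ⊕ Fin n₄) → ℝ) →ₗ[ℝ] (Fin n₁ ⊕ Fin n₂ → ℝ) :=
      LinearMap.funLeft ℝ ℝ Sum.inl
    have hgen (k : ℕ) (i : u) :
        π (e ((P.A ^ k * P.B).col i)) = (Ac ^ k * Bc).col i := by
      have : T * (P.A ^ k * P.B) = ι * (Ac ^ k * Bc) := by
        rw [← Matrix.mul_assoc, ← pow_mul_eq_mul_pow_of_mul_eq hTA.symm, Matrix.mul_assoc,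
          ← Matrix.mul_assoc ι, ← pow_mul_eq_mul_pow_of_mul_eq hAι, Matrix.mul_assoc, ← hBι]
      have h1 : e ((P.A ^ k * P.B).col i) = (ι * (Ac ^ k * Bc)).col i := by
        rw [← hT, ← this]
        rfl
      rw [h1]
      ext j
      simp [π, ι, Matrix.fromRows_mul, LinearMap.funLeft_apply]
    rw [IsControllable, eq_top_iff]
    rintro x -
    let X : (Fin n₁ ⊕ Fin n₂) ⊕ (Fin n₃ ⊕ Fin n₄) → ℝ := Sum.elim x 0
    have hX : e.symm X ∈ reachableSubspace P.A P.B := by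
      rw [hR]
      simp [X]
    have hmap : reachableSubspace P.A P.B ≤ (Submodule.span ℝ (Set.range fun q : ℕ × u =>
        (Ac ^ q.1 * Bc).col q.2)).comap (π ∘ₗ e.toLinearMap) := by
      refine Submodule.span_le.2 ?_
      rintro _ ⟨⟨k, i⟩, rfl⟩
      exact Submodule.subset_span ⟨(k, i), (hgen k i).symm⟩
    have := hmap hX
    simpa [π, X, LinearMap.funLeft] using this
  · set Ao := Matrix.fromBlocks A'.toBlocks₁₁.toBlocks₁₁ A'.toBlocks₁₂.toBlocks₁₁ 0
        A'.toBlocks₂₂.toBlocks₁₁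
    set Co := Matrix.fromCols C'.toCols₁.toCols₁ C'.toCols₂.toCols₁
    -- `ρ` projects the whole state space onto blocks 1 and 3, intertwining `A'` with `Ao`.
    let ρ : Matrix (Fin n₁ ⊕ Fin n₃) ((Fin n₁ ⊕ Fin n₂) ⊕ (Fin n₃ ⊕ Fin n₄)) ℝ :=
      Matrix.fromBlocks (Matrix.fromCols 1 0) 0 0 (Matrix.fromCols 1 0)
    have hρA : Ao * ρ = ρ * A' := by
      rw [A_eq]
      simp [ρ, Ao, Matrix.fromBlocks_multiply, Matrix.fromCols_mul_fromBlocks, Matrix.mul_fromCols]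
    have hCρ : C' = Co * ρ := by
      rw [C_eq]
      simp [ρ, Co, Matrix.fromCols_mul_fromBlocks, Matrix.mul_fromCols]
    intro x hx
    let X : (Fin n₁ ⊕ Fin n₂) ⊕ (Fin n₃ ⊕ Fin n₄) → ℝ :=
      Sum.elim (Sum.elim (x ∘ Sum.inl) 0) (Sum.elim (x ∘ Sum.inr) 0)
    have hρX : ρ.mulVec X = x := by
      ext (i | i) <;>
      simp [ρ, X, Matrix.fromBlocks_mulVec, Matrix.fromCols_mulVec]
    have hX : e.symm X ∈ unobservableSubspace P.C P.A := by
      rw [mem_unobservableSubspace]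
      intro k
      rw [← hS, Matrix.mulVec_mulVec, Matrix.mul_assoc, pow_mul_eq_mul_pow_of_mul_eq hAS,
        ← Matrix.mul_assoc]
      change (C' * A' ^ k).mulVec X = 0
      rw [hCρ, Matrix.mul_assoc, ← pow_mul_eq_mul_pow_of_mul_eq hρA, ← Matrix.mul_assoc,
        ← Matrix.mulVec_mulVec, hρX, hx k]
    rw [hN, LinearEquiv.apply_symm_apply] at hX
    ext (i | i)
    · exact hX.1 i
    · exact hX.2 i

section

open MeasureTheory Matrix

/-! ### The controllable and observable block -/

theorem IsControllable.of_surjective_of_mul_eq {m n u : Type} [Fintype m] [DecidableEq m]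
    [Fintype n] [DecidableEq n] {A : Matrix m m ℝ} {B : Matrix m u ℝ} {A' : Matrix n n ℝ}
    {B' : Matrix n u ℝ} {T : Matrix n m ℝ} (h : IsControllable A B)
    (hT : Function.Surjective T.mulVec) (hA : A' * T = T * A) (hB : T * B = B') :
    IsControllable A' B' := by
  have hle : (⊤ : Submodule ℝ (m → ℝ)) ≤ (Submodule.span ℝ (Set.range fun q : ℕ × u =>
      (A' ^ q.1 * B').col q.2)).comap T.mulVecLin := by
    rw [← h]
    refine Submodule.span_le.2 ?_
    rintro _ ⟨⟨k, i⟩, rfl⟩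
    refine Submodule.subset_span ⟨(k, i), ?_⟩
    simp only
    rw [← hB, ← Matrix.mul_assoc, pow_mul_eq_mul_pow_of_mul_eq hA, Matrix.mul_assoc]
    rfl
  rw [IsControllable, eq_top_iff]
  rintro x -
  obtain ⟨y, rfl⟩ := hT x
  exact hle Submodule.mem_top

theorem IsObservable.of_injective_of_mul_eq {m n y : Type} [Fintype m] [DecidableEq m]
    [Fintype n] [DecidableEq n] {A : Matrix m m ℝ} {C : Matrix y m ℝ} {A' : Matrix n n ℝ}
    {C' : Matrix y n ℝ} {S : Matrix m n ℝ} (h : IsObservable C A)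
    (hS : Function.Injective S.mulVec) (hA : A * S = S * A') (hC : C * S = C') :
    IsObservable C' A' := by
  intro x hx
  refine hS ?_
  rw [Matrix.mulVec_zero]
  refine h _ fun k => ?_
  rw [Matrix.mulVec_mulVec, Matrix.mul_assoc, pow_mul_eq_mul_pow_of_mul_eq hA, ← Matrix.mul_assoc,
    hC, hx k]

namespace KalmanForm

theorem isControllable_block₁ {n u y : Type} [Fintype n] [DecidableEq n] {P : StateSpace n u y}
    (κ : KalmanForm P) : IsControllable κ.A₁₁ κ.B₁ := by
  refine κ.controllable.of_surjective_of_mul_eq (T := fromCols 1 0) (fun x => ?_) ?_ ?_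
  · exact ⟨Sum.elim x 0, by simp [fromCols_mulVec]⟩
  · simp [fromCols_mul_fromBlocks, mul_fromCols]
  · simp [fromCols_mul_fromRows]

theorem isObservable_block₁ {n u y : Type} [Fintype n] [DecidableEq n] {P : StateSpace n u y}
    (κ : KalmanForm P) : IsObservable κ.C₁ κ.A₁₁ := by
  refine κ.observable.of_injective_of_mul_eq (S := fromRows 1 0) (fun x x' h => ?_) ?_ ?_
  · ext i
    simpa [fromRows_mulVec] using congrFun h (Sum.inl i)
  · simp [fromBlocks_mul_fromRows, fromRows_mul]
  · simp [fromCols_mul_fromRows]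

end KalmanForm

/-! ### Characteristic polynomial of the closed loop -/

/-- Conjugation invariance of the characteristic polynomial for a change of basis between different
index types. -/
theorem Matrix.charpoly_conj_of_mul_eq_one {m n R : Type*} [Fintype m] [DecidableEq m] [Fintype n]
    [DecidableEq n] [CommRing R] [Nontrivial R] {T : Matrix m n R} {S : Matrix n m R}
    (hTS : T * S = 1) (hST : S * T = 1) (M : Matrix n n R) :
    (T * M * S).charpoly = M.charpoly := by
  have hcard : Fintype.card m = Fintype.card n := by
    simpa using (Matrix.toLin'OfInv hST hTS).finrank_eq.symm
  rw [charpoly_mul_comm_of_le _ _ hcard.ge, hcard, Nat.sub_self, pow_zero, one_mul,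
    ← Matrix.mul_assoc, hST, Matrix.one_mul]

/-- The separation principle: the modes of an observer-based loop are those of the state feedback
and those of the observer. In the coordinates `(x, x - w)`, with `w` the state of the observer, the
loop is block triangular. -/
theorem charpoly_observer_loop {k u y : Type} [Fintype k] [DecidableEq k] [Fintype u] [Fintype y]
    (A : Matrix k k ℝ) (B : Matrix k u ℝ) (C : Matrix y k ℝ) (F : Matrix u k ℝ)
    (L : Matrix k y ℝ) :
    (fromBlocks A (-(B * F)) (L * C) (A - B * F - L * C)).charpoly =
      (A - B * F).charpoly * (A - L * C).charpoly := by
  have hS : (fromBlocks 1 0 1 (-1) : Matrix (k ⊕ k) (k ⊕ k) ℝ) * fromBlocks 1 0 1 (-1) = 1 := by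
    simp [fromBlocks_multiply]
  rw [← charpoly_conj_of_mul_eq_one hS hS, ← charpoly_fromBlocks_zero₂₁ (M₁₂ := B * F)]
  congr 1
  simp only [fromBlocks_multiply]
  congr 1 <;> simp <;> abel

/-- The observer-based controller acts on block 1 of the Kalman form only; the modes of the other
blocks remain modes of the closed loop. -/
theorem KalmanForm.charpoly_lft_observerController {n u y : Type} [Fintype n] [DecidableEq n]
    [Fintype u] [DecidableEq u] [Fintype y] [DecidableEq y] {P : StateSpace n u y}
    (κ : KalmanForm P) (F : Matrix u (Fin κ.n₁) ℝ) (L : Matrix (Fin κ.n₁) y ℝ) :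
    (P.lft (κ.observerController F L)).A.charpoly =
      (κ.A₁₁ - κ.B₁ * F).charpoly * (κ.A₁₁ - L * κ.C₁).charpoly *
        (κ.A₂₂.charpoly * κ.A₃₃.charpoly * κ.A₄₄.charpoly) := by
  have hA : (P.lft (κ.observerController F L)).A =
      fromBlocks P.A (-(P.B * F)) (L * P.C) (κ.A₁₁ - κ.B₁ * F - L * κ.C₁) := by
    simp only [StateSpace.lft, KalmanForm.observerController]
    congr 1 <;> simp
  let T : Matrix (((Fin κ.n₁ ⊕ Fin κ.n₂) ⊕ (Fin κ.n₃ ⊕ Fin κ.n₄)) ⊕ Fin κ.n₁) (n ⊕ Fin κ.n₁) ℝ :=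
    fromBlocks κ.T 0 0 1
  let S : Matrix (n ⊕ Fin κ.n₁) (((Fin κ.n₁ ⊕ Fin κ.n₂) ⊕ (Fin κ.n₃ ⊕ Fin κ.n₄)) ⊕ Fin κ.n₁) ℝ :=
    fromBlocks κ.Tinv 0 0 1
  have hTS : T * S = 1 := by simp [T, S, fromBlocks_multiply, κ.T_mul_Tinv]
  have hST : S * T = 1 := by simp [T, S, fromBlocks_multiply, κ.Tinv_mul_T]
  have hconj : T * (P.lft (κ.observerController F L)).A * S =
      fromBlocks (κ.T * P.A * κ.Tinv) (-(κ.T * P.B * F)) (L * (P.C * κ.Tinv))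
        (κ.A₁₁ - κ.B₁ * F - L * κ.C₁) := by
    simp [hA, T, S, fromBlocks_multiply, Matrix.mul_assoc]
  -- In the order 2, (1, controller), 4, 3 the closed loop is block upper triangular.
  let e : ((Fin κ.n₁ ⊕ Fin κ.n₂) ⊕ (Fin κ.n₃ ⊕ Fin κ.n₄)) ⊕ Fin κ.n₁ ≃
      Fin κ.n₂ ⊕ ((Fin κ.n₁ ⊕ Fin κ.n₁) ⊕ (Fin κ.n₄ ⊕ Fin κ.n₃)) :=
    { toFun := Sum.elim (Sum.elim (Sum.elim (fun i => .inr (.inl (.inl i))) .inl)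
        (Sum.elim (fun i => .inr (.inr (.inr i))) fun i => .inr (.inr (.inl i))))
        fun i => .inr (.inl (.inr i))
      invFun := Sum.elim (fun i => .inl (.inl (.inr i)))
        (Sum.elim (Sum.elim (fun i => .inl (.inl (.inl i))) .inr)
          (Sum.elim (fun i => .inl (.inr (.inr i))) fun i => .inl (.inr (.inl i))))
      left_inv := by rintro (((_ | _) | (_ | _)) | _) <;> rfl
      right_inv := by rintro (_ | ((_ | _) | (_ | _))) <;> rfl }
  have hre : reindex e e (T * (P.lft (κ.observerController F L)).A * S) =
      fromBlocks κ.A₂₂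
        (fromCols (fromCols κ.A₂₁ (-(κ.B₂ * F))) (fromCols κ.A₂₄ κ.A₂₃)) 0
        (fromBlocks
          (fromBlocks κ.A₁₁ (-(κ.B₁ * F)) (L * κ.C₁) (κ.A₁₁ - κ.B₁ * F - L * κ.C₁))
          (fromBlocks 0 κ.A₁₃ 0 (L * κ.C₃)) 0
          (fromBlocks κ.A₄₄ κ.A₄₃ 0 κ.A₃₃)) := by
    rw [hconj, κ.A_eq, κ.B_eq, κ.C_eq]
    simp only [fromRows_mul, mul_fromCols, Matrix.zero_mul, Matrix.mul_zero]
    ext (i | ((i | i) | (i | i))) (j | ((j | j) | (j | j))) <;> simp [e]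
  rw [← charpoly_conj_of_mul_eq_one hTS hST, ← charpoly_reindex e, hre]
  simp only [charpoly_fromBlocks_zero₂₁, charpoly_observer_loop]
  ring

theorem eigMult_eq {n : Type} [Fintype n] [DecidableEq n] (z : ℂ) (A : Matrix n n ℝ) :
    eigMult z A = (A.charpoly.map (algebraMap ℝ ℂ)).rootMultiplicity z := by
  rw [eigMult, charpoly_map]

theorem mem_eig_iff_eigMult_ne_zero {n : Type} [Fintype n] [DecidableEq n] {z : ℂ}
    {A : Matrix n n ℝ} : z ∈ eig A ↔ eigMult z A ≠ 0 := by
  rw [eig, mem_spectrum_iff_isRoot_charpoly, eigMult, ← Nat.pos_iff_ne_zero,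
    Polynomial.rootMultiplicity_pos (charpoly_monic _).ne_zero]

theorem IsStable.eigMult_eq_zero {n : Type} [Fintype n] [DecidableEq n] {A : Matrix n n ℝ}
    (h : IsStable A) {z : ℂ} (hz : 0 ≤ z.re) : eigMult z A = 0 := by
  by_contra h0
  exact (h z (mem_eig_iff_eigMult_ne_zero.2 h0)).not_ge hz

theorem KalmanForm.StabilizingGains.stabilizesControllableObservable {n u y : Type} [Fintype n]
    [DecidableEq n] [Fintype u] [DecidableEq u] [Fintype y] [DecidableEq y] {P : StateSpace n u y}
    {κ : KalmanForm P} {F : Matrix u (Fin κ.n₁) ℝ} {L : Matrix (Fin κ.n₁) y ℝ}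
    (h : κ.StabilizingGains F L) :
    κ.StabilizesControllableObservable (κ.observerController F L) := by
  intro z hz
  have h1 := h.1.eigMult_eq_zero hz
  have h2 := h.2.eigMult_eq_zero hz
  have hne {k : Type} [Fintype k] [DecidableEq k] (M : Matrix k k ℝ) :
      M.charpoly.map (algebraMap ℝ ℂ) ≠ 0 := (M.charpoly_monic.map _).ne_zero
  simp only [eigMult_eq] at h1 h2 ⊢
  rw [κ.charpoly_lft_observerController]
  simp only [Polynomial.map_mul]
  rw [Polynomial.rootMultiplicity_mul (by simp [hne]),
    Polynomial.rootMultiplicity_mul (by simp [hne]),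
    Polynomial.rootMultiplicity_mul (by simp [hne]),
    Polynomial.rootMultiplicity_mul (by simp [hne]), h1, h2, zero_add, zero_add]

theorem KalmanForm.StabilizingGains.unstableEig_lft_subset {n u y : Type} [Fintype n]
    [DecidableEq n] [Fintype u] [DecidableEq u] [Fintype y] [DecidableEq y] {P : StateSpace n u y}
    {κ : KalmanForm P} {F : Matrix u (Fin κ.n₁) ℝ} {L : Matrix (Fin κ.n₁) y ℝ}
    (h : κ.StabilizingGains F L) :
    unstableEig (P.lft (κ.observerController F L)).A ⊆
      {z | z ∈ eig κ.A₂₂ ∪ eig κ.A₃₃ ∪ eig κ.A₄₄ ∧ 0 ≤ z.re} := by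
  rintro z ⟨hz, hre⟩
  refine ⟨?_, hre⟩
  rw [mem_eig_iff_eigMult_ne_zero, h.stabilizesControllableObservable z hre] at hz
  simp only [Set.mem_union, mem_eig_iff_eigMult_ne_zero]
  omega

/-! ### Perturbation of the observer gain -/

theorem isOpen_setOf_isStable {n : Type} [Fintype n] [DecidableEq n] :
    IsOpen {A : Matrix n n ℝ | IsStable A} := by
  let _ : NormedRing (Matrix n n ℂ) := Matrix.linftyOpNormedRing
  let _ : NormedAlgebra ℂ (Matrix n n ℂ) := Matrix.linftyOpNormedAlgebra
  have : CompleteSpace (Matrix n n ℂ) := FiniteDimensional.complete ℂ _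
  exact (upperHemicontinuous_iff_isOpen_preimage_Iic.1
    (upperHemicontinuous_spectrum ℂ (Matrix n n ℂ)) {z : ℂ | z.re < 0}
    (isOpen_lt Complex.continuous_re continuous_const)).preimage
    (continuous_id.matrix_map (continuous_algebraMap ℝ ℂ))

/-- A proper level set of a linear map is null. -/
theorem ae_linearMap_ne {E V : Type*} [NormedAddCommGroup E] [NormedSpace ℝ E]
    [FiniteDimensional ℝ E] [MeasurableSpace E] [BorelSpace E] [AddCommGroup V] [Module ℝ V]
    (μ : Measure E) [μ.IsAddHaarMeasure] (φ : E →ₗ[ℝ] V) {c : V} (h : ∃ x, φ x ≠ c) :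
    ∀ᵐ x ∂μ, φ x ≠ c := by
  let s : AffineSubspace ℝ E := (AffineSubspace.mk' c ⊥).comap φ.toAffineMap
  have hs (x : E) : x ∈ s ↔ φ x = c := by
    simp [s, AffineSubspace.mem_mk', sub_eq_zero]
  have hne : s ≠ ⊤ := by
    rintro htop
    obtain ⟨x, hx⟩ := h
    exact hx ((hs x).1 (htop ▸ AffineSubspace.mem_top ℝ E x))
  have := Measure.addHaar_affineSubspace μ s hne
  rw [ae_iff]
  convert this using 2
  ext x
  simp [hs]

/-- If `z` is not an eigenvalue of `M`, then for almost every `l` it is not an eigenvalue of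
`M - (L + l) G` either. By the matrix determinant lemma `det (z - M + (L + l) G)` is an affine
function of `l`, and it does not vanish at `l = -L`. -/
theorem ae_notMem_eig_sub_mul {k : ℕ} {M : Matrix (Fin k) (Fin k) ℝ} {z : ℂ} (hz : z ∉ eig M)
    (L : Matrix (Fin k) (Fin 1) ℝ) (G : Matrix (Fin 1) (Fin k) ℝ) :
    ∀ᵐ l : Fin k → ℝ, z ∉ eig (M - (L + replicateCol (Fin 1) l) * G) := by
  let Z : Matrix (Fin k) (Fin k) ℂ := algebraMap ℂ _ z - M.map (algebraMap ℝ ℂ)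
  have hZ : IsUnit Z.det := by
    rw [← isUnit_iff_isUnit_det]
    exact spectrum.notMem_iff.1 hz
  let W : Matrix (Fin 1) (Fin k) ℂ := G.map (algebraMap ℝ ℂ) * Z⁻¹
  let φ : (Fin k → ℝ) →ₗ[ℝ] ℂ := Fintype.linearCombination ℝ (W 0)
  have hφ (U : Matrix (Fin k) (Fin 1) ℝ) :
      (1 + W * U.map (algebraMap ℝ ℂ)).det = 1 + φ (U.col 0) := by
    simp [φ, Matrix.mul_apply, Fintype.linearCombination_apply, mul_comm]
  have hiff (l : Fin k → ℝ) : z ∉ eig (M - (L + replicateCol (Fin 1) l) * G) ↔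
      φ l ≠ -1 - φ (L.col 0) := by
    have h1 : algebraMap ℂ (Matrix (Fin k) (Fin k) ℂ) z -
        (M - (L + replicateCol (Fin 1) l) * G).map (algebraMap ℝ ℂ) =
        Z + (L + replicateCol (Fin 1) l).map (algebraMap ℝ ℂ) * G.map (algebraMap ℝ ℂ) := by
      rw [← Matrix.map_mul, Matrix.map_sub _ (map_sub _)]
      simp only [Z]
      abel
    have h2 : (L + replicateCol (Fin 1) l).col 0 = L.col 0 + l := rfl
    rw [eig, spectrum.notMem_iff, h1, isUnit_iff_isUnit_det, det_add_mul _ _ hZ, hφ, h2, map_add,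
      IsUnit.mul_iff, and_iff_right hZ, isUnit_iff_ne_zero, not_iff_not]
    constructor <;> intro h <;> linear_combination h
  simp only [hiff]
  refine ae_linearMap_ne _ φ ⟨-L.col 0, fun h => ?_⟩
  rw [map_neg] at h
  exact one_ne_zero (by linear_combination h)

/-- A small perturbation of the observer gain keeps the gains stabilizing, and almost every such
perturbation moves the controller modes off the unstable closed-loop modes. The latter lie in a
finite set that does not depend on the perturbation, so it is enough to avoid one point at a
time. -/
theorem KalmanForm.StabilizingGains.exists_perturbation {n : Type} [Fintype n] [DecidableEq n]
    {P : StateSpace n (Fin 1) (Fin 1)} {κ : KalmanForm P} {F : Matrix (Fin 1) (Fin κ.n₁) ℝ}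
    {L : Matrix (Fin κ.n₁) (Fin 1) ℝ} (h : κ.StabilizingGains F L) :
    ∃ ε : ℝ, 0 < ε ∧
      (∀ l : Fin κ.n₁ → ℝ, ‖l‖ < ε → κ.StabilizingGains F (L + replicateCol (Fin 1) l)) ∧
      (∀ᵐ l : Fin κ.n₁ → ℝ, ‖l‖ < ε →
        unstableEig (κ.observerController F (L + replicateCol (Fin 1) l)).A ∩
          unstableEig (P.lft (κ.observerController F (L + replicateCol (Fin 1) l))).A = ∅) := by
  have hcont : Continuous fun l : Fin κ.n₁ → ℝ =>
      κ.A₁₁ - (L + replicateCol (Fin 1) l) * κ.C₁ := by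
    fun_prop
  obtain ⟨ε, hε, hball⟩ := Metric.isOpen_iff.1 (isOpen_setOf_isStable.preimage hcont) 0 (by
    have : L + replicateCol (Fin 1) (0 : Fin κ.n₁ → ℝ) = L := by simp
    simpa [this] using h.2)
  have hgains (l : Fin κ.n₁ → ℝ) (hl : ‖l‖ < ε) :
      κ.StabilizingGains F (L + replicateCol (Fin 1) l) :=
    ⟨h.1, hball (by simpa using hl)⟩
  refine ⟨ε, hε, hgains, ?_⟩
  have hfin : {z : ℂ | z ∈ eig κ.A₂₂ ∪ eig κ.A₃₃ ∪ eig κ.A₄₄ ∧ 0 ≤ z.re}.Finite :=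
    (((finite_spectrum _).union (finite_spectrum _)).union (finite_spectrum _)).subset
      fun z hz => hz.1
  filter_upwards [(ae_ball_iff hfin.countable).2 fun z hz =>
    ae_notMem_eig_sub_mul (fun hmem => (h.1 z hmem).not_ge hz.2) L (κ.C₁ - P.D * F)]
    with l hl hlε
  have hA : (κ.observerController F (L + replicateCol (Fin 1) l)).A =
      κ.A₁₁ - κ.B₁ * F - (L + replicateCol (Fin 1) l) * (κ.C₁ - P.D * F) := by
    rw [KalmanForm.observerController, Matrix.mul_sub, Matrix.mul_assoc]
    abel_nf
  refine Set.disjoint_iff_inter_eq_empty.1 (Set.disjoint_right.2 fun z hz hzK => ?_)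
  exact hl z ((hgains l hlε).unstableEig_lft_subset hz) (hA ▸ hzK.1)

end

theorem mainTheorem8 {n : ℕ} (Pm : StateSpace (Fin n) (Fin 1) (Fin 1)) :
    Nonempty (KalmanForm Pm) ∧
    ∀ κ : KalmanForm Pm,
      (∃ (F : Matrix (Fin 1) (Fin κ.n₁) ℝ) (L : Matrix (Fin κ.n₁) (Fin 1) ℝ),
        κ.StabilizingGains F L ∧
        κ.StabilizesControllableObservable (κ.observerController F L) ∧
        unstableEig (κ.observerController F L).A ∩
          unstableEig (Pm.lft (κ.observerController F L)).A = ∅) ∧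
      (∀ (F : Matrix (Fin 1) (Fin κ.n₁) ℝ) (L : Matrix (Fin κ.n₁) (Fin 1) ℝ),
        κ.StabilizingGains F L →
        κ.StabilizesControllableObservable (κ.observerController F L) ∧
        ∃ ε : ℝ, 0 < ε ∧
          (∀ l : Fin κ.n₁ → ℝ, ‖l‖ < ε →
            κ.StabilizingGains F (L + Matrix.replicateCol (Fin 1) l) ∧
            κ.StabilizesControllableObservable
              (κ.observerController F (L + Matrix.replicateCol (Fin 1) l))) ∧
          (∀ᵐ l : Fin κ.n₁ → ℝ ∂MeasureTheory.volume, ‖l‖ < ε →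
            unstableEig (κ.observerController F (L + Matrix.replicateCol (Fin 1) l)).A ∩
              unstableEig
                (Pm.lft (κ.observerController F (L + Matrix.replicateCol (Fin 1) l))).A = ∅)) := by
  refine ⟨KalmanForm.nonempty Pm, fun κ => ⟨?_, fun F L h =>
    ⟨h.stabilizesControllableObservable, ?_⟩⟩⟩
  · obtain ⟨F, hF⟩ := κ.isControllable_block₁.exists_isStable
    obtain ⟨L, hL⟩ := κ.isObservable_block₁.exists_isStable
    have h : κ.StabilizingGains F L := ⟨hF, hL⟩
    obtain ⟨ε, hε, hst, hae⟩ := h.exists_perturbation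
    -- A property that holds almost everywhere holds somewhere in the open ball of radius `ε`.
    obtain ⟨l, hl, hlε⟩ := (MeasureTheory.Measure.dense_of_ae hae).exists_mem_open
      Metric.isOpen_ball ⟨0, Metric.mem_ball_self hε⟩
    rw [mem_ball_zero_iff] at hlε
    exact ⟨F, _, hst l hlε, (hst l hlε).stabilizesControllableObservable, hl hlε⟩
  · obtain ⟨ε, hε, hst, hae⟩ := h.exists_perturbation
    exact ⟨ε, hε, fun l hl => ⟨hst l hl, (hst l hl).stabilizesControllableObservable⟩, hae⟩
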